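/- All spaces are Tychonoff. For a family $\mathcal S$ of subsets of a set, $\mathcal S_\sigma$ and $\mathcal S_\delta$ denote the families of all countable unions and of all countable intersections of elements of $\mathcal S$. For a topological space $Y$ define: * the Borel classes: $\mathcal M_0(Y)=\mathcal A_0(Y)$ is the algebra of sets generated by the open subsets of $Y$, and for $1\le\alpha<\omega_1$, $\mathcal M_\alpha(Y)=\big(\bigcup_{\beta<\alpha}(\mathcal M_\beta(Y)\cup\mathcal A_\beta(Y))\big)_\delta$ and $\mathcal A_\alpha(Y)=\big(\bigcup_{\beta<\alpha}(\mathcal M_\beta(Y)\cup\mathcal A_\beta(Y))\big)_\sigma$; * the $\mathcal F$-Borel classes: $\mathcal F_1(Y)$ is the family of closed subsets of $Y$, and $\mathcal F_\alpha(Y)$ is $\big(\bigcup_{1\le\beta<\alpha}\mathcal F_\beta(Y)\big)_\sigma$ for even $2\le\alpha<\omega_1$ and $\big(\bigcup_{1\le\beta<\alpha}\mathcal F_\beta(Y)\big)_\delta$ for odd $3\le\alpha<\omega_1$ (an ordinal $\lambda+n$, with $\lambda$ zero or a limit and $n\in\omega$, has the parity of $n$); * the $\mathcal G$-Borel classes: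 $\mathcal G_\alpha(Y)$, $1\le\alpha<\omega_1$, consists of the complements of the elements of $\mathcal F_\alpha(Y)$. A descriptive class $\mathcal C$ is one of $\mathcal M_\alpha,\mathcal A_\alpha$ ($0\le\alpha<\omega_1$), $\mathcal F_\alpha,\mathcal G_\alpha$ ($1\le\alpha<\omega_1$). A compactification of $X$ is a compact Hausdorff space $cX$ together with a homeomorphic embedding of $X$ onto a dense subspace of $cX$; when $X$ is embedded in $Y$, "$X\in\mathcal C(Y)$" means that the image of $X$ belongs to $\mathcal C(Y)$. A space $X$ is a $\mathcal C$ space if $X\in\mathcal C(cX)$ for some compactification $cX$ of $X$, and an absolute $\mathcal C$ space if $X\in\mathcal C(Y)$ for every Tychonoff space $Y$ in which $X$ is densely embedded. **Theorem.** Let $\mathcal C$ be a descriptive class. Then every separable metrizable $\mathcal C$ space is an absolute $\mathcal C$ space. In other words, for a separable metrizable space $X$ the following are equivalent: 1. $X\in\mathcal C(cX)$ for some compactification $cX$ of $X$; 2. $X\in\mathcal C(\beta X)$, where $\beta X$ is the Čech–Stone compactification of $X$; 3. $X\in\mathcal C(cX)$ for every compactification $cX$ of $X$; 4. $X\in\mathcal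 C(Y)$ for every Tychonoff space $Y$ in which $X$ is densely embedded. If $\mathcal C$ is one of the Borel classes $\mathcal M_\alpha,\mathcal A_\alpha$ or one of the $\mathcal F$-Borel classes $\mathcal F_\alpha$, these are further equivalent to 5. $X\in\mathcal C(Y)$ for every Tychonoff space $Y$ in which $X$ is embedded. -/

import Mathlib

open Set Topology TopologicalSpace

universe u

/-- `𝒞_σ`: all countable unions of elements of `𝒞`. -/
def countableUnions {X : Type u} (𝒞 : Set (Set X)) : Set (Set X) :=
  {s | ∃ f : ℕ → Set X, (∀ n, f n ∈ 𝒞) ∧ s = ⋃ n, f n}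

/-- `𝒞_δ`: all countable intersections of elements of `𝒞`. -/
def countableInters {X : Type u} (𝒞 : Set (Set X)) : Set (Set X) :=
  {s | ∃ f : ℕ → Set X, (∀ n, f n ∈ 𝒞) ∧ s = ⋂ n, f n}

/-- An ordinal is even if it is `l + n` with `l` zero or a limit ordinal and `n` an even natural
number; the other ordinals are odd. -/
def OrdinalIsEven (α : Ordinal.{0}) : Prop :=
  ∃ (l : Ordinal.{0}) (n : ℕ), Order.IsSuccPrelimit l ∧ Even n ∧ α = l + n

/-- The pair `(𝓜_α(X), 𝓐_α(X))`. Both components at `0` are the algebra of sets generated by the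
open sets; for `α ≥ 1` they are `(⋃_{β<α} (𝓜_β ∪ 𝓐_β))_δ` and `(⋃_{β<α} (𝓜_β ∪ 𝓐_β))_σ`. -/
noncomputable def borelClasses (X : Type u) [TopologicalSpace X] (α : Ordinal.{0}) :
    Set (Set X) × Set (Set X) :=
  open Classical in
  if α = 0 then
    (MeasureTheory.generateSetAlgebra {s : Set X | IsOpen s},
      MeasureTheory.generateSetAlgebra {s : Set X | IsOpen s})
  else
    (countableInters (⋃ (β : Ordinal.{0}) (_ : β < α), (borelClasses X β).1 ∪ (borelClasses X β).2),
      countableUnions (⋃ (β : Ordinal.{0}) (_ : β < α), (borelClasses X β).1 ∪ (borelClasses X β).2))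
termination_by α

/-- The multiplicative Borel class `𝓜_α(X)`. -/
noncomputable def multiplicativeBorel (X : Type u) [TopologicalSpace X] (α : Ordinal.{0}) :
    Set (Set X) :=
  (borelClasses X α).1

/-- The additive Borel class `𝓐_α(X)`. -/
noncomputable def additiveBorel (X : Type u) [TopologicalSpace X] (α : Ordinal.{0}) :
    Set (Set X) :=
  (borelClasses X α).2

/-- The class `𝓕_α(X)`, for `α ≥ 1`: closed sets for `α = 1`, `(⋃_{1≤β<α} 𝓕_β)_σ` for even
`α ≥ 2`, and `(⋃_{1≤β<α} 𝓕_β)_δ` for odd `α ≥ 3`. The hierarchy starts at `1`, so the value at `0`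
is the empty family. -/
noncomputable def fBorel (X : Type u) [TopologicalSpace X] (α : Ordinal.{0}) : Set (Set X) :=
  open Classical in
  if α = 0 then ∅
  else if α = 1 then {s | IsClosed s}
  else if OrdinalIsEven α then
    countableUnions (⋃ (β : Ordinal.{0}) (_ : β < α), fBorel X β)
  else
    countableInters (⋃ (β : Ordinal.{0}) (_ : β < α), fBorel X β)
termination_by α

/-- The class `𝓖_α(X)`: complements of the sets in `𝓕_α(X)`. -/
noncomputable def gBorel (X : Type u) [TopologicalSpace X] (α : Ordinal.{0}) : Set (Set X) :=
  {s | sᶜ ∈ fBorel X α}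

/-- A descriptive class of sets: one of the Borel classes `𝓜_α`, `𝓐_α` (`α < ω₁`), or one of the
classes `𝓕_α`, `𝓖_α` (`1 ≤ α < ω₁`). -/
inductive DescriptiveClass : Type 1
  | multiplicative (α : Ordinal.{0}) (hα : α < Ordinal.omega 1) : DescriptiveClass
  | additive (α : Ordinal.{0}) (hα : α < Ordinal.omega 1) : DescriptiveClass
  | F (α : Ordinal.{0}) (one_le : 1 ≤ α) (hα : α < Ordinal.omega 1) : DescriptiveClass
  | G (α : Ordinal.{0}) (one_le : 1 ≤ α) (hα : α < Ordinal.omega 1) : DescriptiveClass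

namespace DescriptiveClass

/-- The family `𝒞(Y)` of subsets of a topological space `Y`. -/
noncomputable def sets (C : DescriptiveClass) (Y : Type u) [TopologicalSpace Y] : Set (Set Y) :=
  match C with
  | multiplicative α _ => multiplicativeBorel Y α
  | additive α _ => additiveBorel Y α
  | F α _ _ => fBorel Y α
  | G α _ _ => gBorel Y α

/-- `𝒞` is one of the Borel classes or one of the `𝓕`-Borel classes. -/
def IsBorelOrFBorel (C : DescriptiveClass) : Prop :=
  match C with
  | multiplicative _ _ => True
  | additive _ _ => True
  | F _ _ _ => True
  | G _ _ _ => False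

end DescriptiveClass

/-- `φ : X → K` is a compactification of `X`: `K` is a compact (Hausdorff) space and `φ` is a
homeomorphic embedding of `X` onto a dense subspace of `K`. -/
structure IsCompactification {X K : Type u} [TopologicalSpace X] [TopologicalSpace K]
    (φ : X → K) : Prop where
  compactSpace : CompactSpace K
  t2Space : T2Space K
  isEmbedding : IsEmbedding φ
  denseRange : DenseRange φ

/-- `X` is a `𝒞` space: it is in `𝒞(cX)` for some compactification `cX`. -/
def IsDescriptiveSpace (C : DescriptiveClass) (X : Type u) [TopologicalSpace X] : Prop :=
  ∃ (K : Type u) (_ : TopologicalSpace K) (φ : X → K), IsCompactification φ ∧ range φ ∈ C.sets K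

/-- `X` is an absolute `𝒞` space: it is in `𝒞(Y)` for every Tychonoff space `Y` in which it is
densely embedded. -/
def IsAbsoluteDescriptiveSpace (C : DescriptiveClass) (X : Type u) [TopologicalSpace X] : Prop :=
  ∀ (Y : Type u) [TopologicalSpace Y] [T35Space Y] (e : X → Y),
    IsEmbedding e → DenseRange e → range e ∈ C.sets Y

/-!
Every extension `Y` of `X` is dominated by `βX`: the extension `p : βX → βY` of the embedding is a
closed continuous surjection, and it sends no point of the remainder into `X`, so that its fibres
over `X` are singletons (`eq_of_map_eq_of_isEmbedding_comp`). Since all the classes are stable under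
continuous preimages, a `𝒞` space lies in `𝒞(βX)`, and it remains to push `X` forward along `p`,
which is `image_mem_sets`; restricting from `βY` to `Y` is again a preimage.

For the push-forward, a set `A` of a Borel or `𝓕`-Borel class in a compact space `K` is written as
`c ⁻¹' Φ`, where `c` is a continuous map to a countable power of the Sierpiński space `Prop` and
`Φ` is a set of the same class there (`IsSierpinskiPullback`). Here `c` amounts to a countable
family of closed sets `F i = {x | ¬ c x i}`. The closed sets `p '' F i` give a continuous map `d`
on the target, and `d ⁻¹' Φ` is of the right class. It contains `p '' A`, but it may contain further
points, because images do not commute with intersections. By compactness, a point `y` outside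
`p '' A` belongs to `d ⁻¹' Φ` only if, for some finite `s`, the fibre over `y` meets every `F i`,
`i ∈ s`, but not their intersection. Such points are removed by intersecting with countably many
sets, one for each `s` (`image_eq_preimage_inter`). These sets are boolean combinations of closed
sets, which settles the multiplicative Borel classes, finitely many of them being enough for `𝓜₀`.
When `X` is hereditarily Lindelöf they can be shrunk to countable unions of closed sets
(`exists_mem_fBorel_two_between`), which settles the `𝓕`-Borel classes of odd index. For classes
formed by countable unions an induction suffices, since subsets of `X` inherit the singleton fibres.
For the `𝓖`-Borel classes one pushes the complement forward, where the points to be avoided have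
singleton fibres and images do commute with intersections at these points
(`exists_mem_fBorel_image_subset`).

For embeddings that are not dense, one passes to the closure of the image; the Borel and `𝓕`-Borel
classes, unlike the `𝓖`-Borel ones, are preserved by closed embeddings.
-/

/-! ### The hierarchies and their stability properties -/

open MeasureTheory in
theorem multiplicativeBorel_zero (X : Type u) [TopologicalSpace X] :
    multiplicativeBorel X 0 = generateSetAlgebra {s : Set X | IsOpen s} := by
  rw [multiplicativeBorel, borelClasses, if_pos rfl]

open MeasureTheory in
theorem additiveBorel_zero (X : Type u) [TopologicalSpace X] :
    additiveBorel X 0 = generateSetAlgebra {s : Set X | IsOpen s} := by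
  rw [additiveBorel, borelClasses, if_pos rfl]

/-- The union of the Borel classes of index less than `α`. -/
def borelBelow (α : Ordinal.{0}) (X : Type u) [TopologicalSpace X] : Set (Set X) :=
  ⋃ (β : Ordinal.{0}) (_ : β < α), multiplicativeBorel X β ∪ additiveBorel X β

/-- The union of the `𝓕`-Borel classes of index less than `α`. -/
def fBelow (α : Ordinal.{0}) (X : Type u) [TopologicalSpace X] : Set (Set X) :=
  ⋃ (β : Ordinal.{0}) (_ : β < α), fBorel X β

section Hierarchies

variable {X : Type u} [TopologicalSpace X] {α : Ordinal.{0}}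

theorem mem_borelBelow {s : Set X} :
    s ∈ borelBelow α X ↔ ∃ β < α, s ∈ multiplicativeBorel X β ∨ s ∈ additiveBorel X β := by
  simp [borelBelow]

theorem mem_fBelow {s : Set X} : s ∈ fBelow α X ↔ ∃ β < α, s ∈ fBorel X β := by
  simp [fBelow]

theorem multiplicativeBorel_of_ne_zero (hα : α ≠ 0) :
    multiplicativeBorel X α = countableInters (borelBelow α X) := by
  rw [multiplicativeBorel, borelClasses, if_neg hα]
  rfl

theorem additiveBorel_of_ne_zero (hα : α ≠ 0) :
    additiveBorel X α = countableUnions (borelBelow α X) := by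
  rw [additiveBorel, borelClasses, if_neg hα]
  rfl

theorem fBorel_zero : fBorel X 0 = ∅ := by
  rw [fBorel, if_pos rfl]

theorem fBorel_one : fBorel X 1 = {s | IsClosed s} := by
  rw [fBorel, if_neg one_ne_zero, if_pos rfl]

theorem fBorel_of_even (h0 : α ≠ 0) (h1 : α ≠ 1) (h : OrdinalIsEven α) :
    fBorel X α = countableUnions (fBelow α X) := by
  rw [fBorel, if_neg h0, if_neg h1, if_pos h]
  rfl

theorem fBorel_of_not_even (h0 : α ≠ 0) (h1 : α ≠ 1) (h : ¬ OrdinalIsEven α) :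
    fBorel X α = countableInters (fBelow α X) := by
  rw [fBorel, if_neg h0, if_neg h1, if_neg h]
  rfl

theorem ordinalIsEven_two : OrdinalIsEven 2 :=
  ⟨0, 2, Order.isSuccPrelimit_bot, even_two, by simp⟩

theorem iUnion_mem_fBorel_two {f : ℕ → Set X} (hf : ∀ n, IsClosed (f n)) :
    ⋃ n, f n ∈ fBorel X 2 := by
  rw [fBorel_of_even two_ne_zero (by norm_num) ordinalIsEven_two]
  exact ⟨f, fun n => mem_fBelow.2 ⟨1, by norm_num, by rw [fBorel_one]; exact hf n⟩, rfl⟩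

theorem isSetAlgebra_multiplicativeBorel_zero :
    MeasureTheory.IsSetAlgebra (multiplicativeBorel X 0) := by
  rw [multiplicativeBorel_zero]
  exact MeasureTheory.isSetAlgebra_generateSetAlgebra

theorem IsOpen.mem_multiplicativeBorel_zero {s : Set X} (hs : IsOpen s) :
    s ∈ multiplicativeBorel X 0 := by
  rw [multiplicativeBorel_zero]
  exact .base s hs

theorem IsClosed.mem_multiplicativeBorel_zero {s : Set X} (hs : IsClosed s) :
    s ∈ multiplicativeBorel X 0 := by
  rw [← compl_compl s]
  exact isSetAlgebra_multiplicativeBorel_zero.compl_mem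
    hs.isOpen_compl.mem_multiplicativeBorel_zero

end Hierarchies

section CountableOperations

variable {X Y : Type*} {𝒞 : Set (Set X)} {𝒟 : Set (Set Y)}

theorem iInter_mem_countableInters {ι : Type*} [Countable ι] [Nonempty ι] {f : ι → Set X}
    (hf : ∀ i, f i ∈ 𝒞) : ⋂ i, f i ∈ countableInters 𝒞 := by
  obtain ⟨e, he⟩ := exists_surjective_nat ι
  exact ⟨fun n => f (e n), fun n => hf _, (he.iInter_comp f).symm⟩

theorem inter_iInter_mem_countableInters {ι : Type*} [Countable ι] {s : Set X} {f : ι → Set X}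
    (hs : s ∈ countableInters 𝒞) (hf : ∀ i, f i ∈ 𝒞) : s ∩ ⋂ i, f i ∈ countableInters 𝒞 := by
  obtain ⟨g, hg, rfl⟩ := hs
  have := iInter_mem_countableInters (𝒞 := 𝒞) (f := Sum.elim g f) (by rintro (n | i) <;> simp [*])
  rwa [iInter_sum] at this

theorem preimage_mem_countableInters {h : Y → X} (H : ∀ s ∈ 𝒞, h ⁻¹' s ∈ 𝒟) {s : Set X} (hs : s ∈ countableInters 𝒞) :
    h ⁻¹' s ∈ countableInters 𝒟 := by
  obtain ⟨f, hf, rfl⟩ := hs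
  exact ⟨fun n => h ⁻¹' f n, fun n => H _ (hf n), preimage_iInter⟩

theorem preimage_mem_countableUnions {h : Y → X} (H : ∀ s ∈ 𝒞, h ⁻¹' s ∈ 𝒟) {s : Set X} (hs : s ∈ countableUnions 𝒞) :
    h ⁻¹' s ∈ countableUnions 𝒟 := by
  obtain ⟨f, hf, rfl⟩ := hs
  exact ⟨fun n => h ⁻¹' f n, fun n => H _ (hf n), preimage_iUnion⟩

theorem image_mem_countableInters {h : X → Y} (hh : h.Injective) (H : ∀ s ∈ 𝒞, h '' s ∈ 𝒟) {s : Set X}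
    (hs : s ∈ countableInters 𝒞) : h '' s ∈ countableInters 𝒟 := by
  obtain ⟨f, hf, rfl⟩ := hs
  exact ⟨fun n => h '' f n, fun n => H _ (hf n), hh.injOn.image_iInter_eq⟩

theorem image_mem_countableUnions {h : X → Y} {s : Set X} (H : ∀ t ∈ 𝒞, t ⊆ s → h '' t ∈ 𝒟)
    (hs : s ∈ countableUnions 𝒞) : h '' s ∈ countableUnions 𝒟 := by
  obtain ⟨f, hf, rfl⟩ := hs
  exact ⟨fun n => h '' f n, fun n => H _ (hf n) (subset_iUnion f n), image_iUnion⟩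

end CountableOperations

section Preimages

variable {X : Type*} {Y : Type*} [TopologicalSpace X] [TopologicalSpace Y] {h : Y → X}

theorem Continuous.preimage_mem_multiplicativeBorel_zero (hh : Continuous h) {s : Set X}
    (hs : s ∈ multiplicativeBorel X 0) : h ⁻¹' s ∈ multiplicativeBorel Y 0 := by
  rw [multiplicativeBorel_zero] at hs
  induction hs with
  | base s hs => exact (IsOpen.preimage hh hs).mem_multiplicativeBorel_zero
  | empty => exact isSetAlgebra_multiplicativeBorel_zero.empty_mem
  | compl s _ ih => exact isSetAlgebra_multiplicativeBorel_zero.compl_mem ih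
  | union s t _ _ ihs iht => exact isSetAlgebra_multiplicativeBorel_zero.union_mem ihs iht

theorem Continuous.preimage_mem_borel (hh : Continuous h) (α : Ordinal.{0}) {s : Set X} :
    (s ∈ multiplicativeBorel X α → h ⁻¹' s ∈ multiplicativeBorel Y α) ∧
      (s ∈ additiveBorel X α → h ⁻¹' s ∈ additiveBorel Y α) := by
  induction α using WellFoundedLT.induction generalizing s with
  | ind α ih =>
    rcases eq_or_ne α 0 with rfl | hα
    · rw [additiveBorel_zero, additiveBorel_zero, ← multiplicativeBorel_zero,
        ← multiplicativeBorel_zero, and_self]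
      exact hh.preimage_mem_multiplicativeBorel_zero
    · have H : ∀ s ∈ borelBelow α X, h ⁻¹' s ∈ borelBelow α Y := by
        intro s hs
        obtain ⟨β, hβ, hs⟩ := mem_borelBelow.1 hs
        exact mem_borelBelow.2 ⟨β, hβ, hs.imp (ih β hβ).1 (ih β hβ).2⟩
      simp only [multiplicativeBorel_of_ne_zero hα, additiveBorel_of_ne_zero hα]
      exact ⟨preimage_mem_countableInters H, preimage_mem_countableUnions H⟩

theorem Continuous.preimage_mem_borelBelow (hh : Continuous h) {α : Ordinal.{0}} {s : Set X}
    (hs : s ∈ borelBelow α X) : h ⁻¹' s ∈ borelBelow α Y := by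
  obtain ⟨β, hβ, hs⟩ := mem_borelBelow.1 hs
  exact mem_borelBelow.2
    ⟨β, hβ, hs.imp (hh.preimage_mem_borel β).1 (hh.preimage_mem_borel β).2⟩

theorem Continuous.preimage_mem_fBorel (hh : Continuous h) (α : Ordinal.{0}) {s : Set X}
    (hs : s ∈ fBorel X α) : h ⁻¹' s ∈ fBorel Y α := by
  induction α using WellFoundedLT.induction generalizing s with
  | ind α ih =>
    rcases eq_or_ne α 0 with rfl | h0
    · simp [fBorel_zero] at hs
    rcases eq_or_ne α 1 with rfl | h1
    · rw [fBorel_one] at hs ⊢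
      exact IsClosed.preimage hh hs
    have H : ∀ s ∈ fBelow α X, h ⁻¹' s ∈ fBelow α Y := by
      intro s hs
      obtain ⟨β, hβ, hs⟩ := mem_fBelow.1 hs
      exact mem_fBelow.2 ⟨β, hβ, ih β hβ hs⟩
    by_cases he : OrdinalIsEven α
    · rw [fBorel_of_even h0 h1 he] at hs ⊢
      exact preimage_mem_countableUnions H hs
    · rw [fBorel_of_not_even h0 h1 he] at hs ⊢
      exact preimage_mem_countableInters H hs

theorem Continuous.preimage_mem_fBelow (hh : Continuous h) {α : Ordinal.{0}} {s : Set X}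
    (hs : s ∈ fBelow α X) : h ⁻¹' s ∈ fBelow α Y := by
  obtain ⟨β, hβ, hs⟩ := mem_fBelow.1 hs
  exact mem_fBelow.2 ⟨β, hβ, hh.preimage_mem_fBorel β hs⟩

theorem Continuous.preimage_mem_sets (hh : Continuous h) (C : DescriptiveClass) {s : Set X}
    (hs : s ∈ C.sets X) : h ⁻¹' s ∈ C.sets Y :=
  match C with
  | .multiplicative α _ => (hh.preimage_mem_borel α).1 hs
  | .additive α _ => (hh.preimage_mem_borel α).2 hs
  | .F α _ _ => hh.preimage_mem_fBorel α hs
  | .G α _ _ => hh.preimage_mem_fBorel α hs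

end Preimages

section ClosedEmbeddings

variable {Z Y : Type*} [TopologicalSpace Z] [TopologicalSpace Y] {i : Z → Y}

theorem Topology.IsClosedEmbedding.image_mem_multiplicativeBorel_zero (hi : IsClosedEmbedding i)
    {s : Set Z} (hs : s ∈ multiplicativeBorel Z 0) : i '' s ∈ multiplicativeBorel Y 0 := by
  have hr : range i ∈ multiplicativeBorel Y 0 := hi.isClosed_range.mem_multiplicativeBorel_zero
  rw [multiplicativeBorel_zero] at hs
  induction hs with
  | base s hs =>
    obtain ⟨t, ht, rfl⟩ := hi.isInducing.isOpen_iff.1 hs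
    rw [image_preimage_eq_inter_range]
    exact isSetAlgebra_multiplicativeBorel_zero.inter_mem ht.mem_multiplicativeBorel_zero hr
  | empty =>
    rw [image_empty]
    exact isSetAlgebra_multiplicativeBorel_zero.empty_mem
  | compl s _ ih =>
    rw [image_compl_eq_range_sdiff_image hi.injective]
    exact isSetAlgebra_multiplicativeBorel_zero.sdiff_mem hr ih
  | union s t _ _ ihs iht =>
    rw [image_union]
    exact isSetAlgebra_multiplicativeBorel_zero.union_mem ihs iht

theorem Topology.IsClosedEmbedding.image_mem_borel (hi : IsClosedEmbedding i) (α : Ordinal.{0})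
    {s : Set Z} :
    (s ∈ multiplicativeBorel Z α → i '' s ∈ multiplicativeBorel Y α) ∧
      (s ∈ additiveBorel Z α → i '' s ∈ additiveBorel Y α) := by
  induction α using WellFoundedLT.induction generalizing s with
  | ind α ih =>
    rcases eq_or_ne α 0 with rfl | hα
    · rw [additiveBorel_zero, additiveBorel_zero, ← multiplicativeBorel_zero,
        ← multiplicativeBorel_zero, and_self]
      exact hi.image_mem_multiplicativeBorel_zero
    · have H : ∀ s ∈ borelBelow α Z, i '' s ∈ borelBelow α Y := by
        intro s hs
        obtain ⟨β, hβ, hs⟩ := mem_borelBelow.1 hs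
        exact mem_borelBelow.2 ⟨β, hβ, hs.imp (ih β hβ).1 (ih β hβ).2⟩
      simp only [multiplicativeBorel_of_ne_zero hα, additiveBorel_of_ne_zero hα]
      exact ⟨image_mem_countableInters hi.injective H,
        image_mem_countableUnions fun t ht _ => H t ht⟩

theorem Topology.IsClosedEmbedding.image_mem_fBorel (hi : IsClosedEmbedding i) (α : Ordinal.{0})
    {s : Set Z} (hs : s ∈ fBorel Z α) : i '' s ∈ fBorel Y α := by
  induction α using WellFoundedLT.induction generalizing s with
  | ind α ih =>
    rcases eq_or_ne α 0 with rfl | h0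
    · simp [fBorel_zero] at hs
    rcases eq_or_ne α 1 with rfl | h1
    · rw [fBorel_one] at hs ⊢
      exact hi.isClosedMap _ hs
    have H : ∀ s ∈ fBelow α Z, i '' s ∈ fBelow α Y := by
      intro s hs
      obtain ⟨β, hβ, hs⟩ := mem_fBelow.1 hs
      exact mem_fBelow.2 ⟨β, hβ, ih β hβ hs⟩
    by_cases he : OrdinalIsEven α
    · rw [fBorel_of_even h0 h1 he] at hs ⊢
      exact image_mem_countableUnions (fun t ht _ => H t ht) hs
    · rw [fBorel_of_not_even h0 h1 he] at hs ⊢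
      exact image_mem_countableInters hi.injective H hs

theorem Topology.IsClosedEmbedding.image_mem_sets (hi : IsClosedEmbedding i) {C : DescriptiveClass}
    (hC : C.IsBorelOrFBorel) {s : Set Z} (hs : s ∈ C.sets Z) : i '' s ∈ C.sets Y :=
  match C, hC with
  | .multiplicative α _, _ => (hi.image_mem_borel α).1 hs
  | .additive α _, _ => (hi.image_mem_borel α).2 hs
  | .F α _ _, _ => hi.image_mem_fBorel α hs

end ClosedEmbeddings

/-! ### Universal sets in powers of the Sierpiński space -/

/-- `A` is the preimage of a set of class `𝒞` under a continuous map to a countable power of the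
Sierpiński space `Prop`, whose only nontrivial open set is `{True}`. Such a map amounts to a
countable family of closed sets, so the set of class `𝒞` plays the part of a formula that
builds `A` from closed sets. -/
def IsSierpinskiPullback {K : Type*} [TopologicalSpace K]
    (𝒞 : ∀ (T : Type) [TopologicalSpace T], Set (Set T)) (A : Set K) : Prop :=
  ∃ (ι : Type) (_ : Countable ι) (c : K → ι → Prop) (Φ : Set (ι → Prop)),
    Continuous c ∧ Φ ∈ 𝒞 (ι → Prop) ∧ A = c ⁻¹' Φ

section Pullbacks

variable {K : Type*} [TopologicalSpace K]
  {𝒞 𝒟 : ∀ (T : Type) [TopologicalSpace T], Set (Set T)}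

theorem IsSierpinskiPullback.mono
    (h : ∀ (T : Type) [TopologicalSpace T], 𝒞 T ⊆ 𝒟 T) {A : Set K}
    (hA : IsSierpinskiPullback 𝒞 A) : IsSierpinskiPullback 𝒟 A := by
  obtain ⟨ι, hι, c, Φ, hc, hΦ, rfl⟩ := hA
  exact ⟨ι, hι, c, Φ, hc, h _ hΦ, rfl⟩

/-- Countably many pullbacks can be realized by a single map to a power of the Sierpiński space. -/
theorem IsSierpinskiPullback.exists_common
    (h𝒞 : ∀ (T T' : Type) [TopologicalSpace T] [TopologicalSpace T'] (h : T → T'),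
      Continuous h → ∀ s ∈ 𝒞 T', h ⁻¹' s ∈ 𝒞 T)
    {f : ℕ → Set K} (hf : ∀ n, IsSierpinskiPullback 𝒞 (f n)) :
    ∃ (ι : Type) (_ : Countable ι) (c : K → ι → Prop) (Φ : ℕ → Set (ι → Prop)),
      Continuous c ∧ (∀ n, Φ n ∈ 𝒞 (ι → Prop)) ∧ ∀ n, f n = c ⁻¹' Φ n := by
  choose ι hι c Φ hc hΦ hf using hf
  refine ⟨Σ n, ι n, inferInstance, fun x i => c i.1 x i.2,
    fun n => (fun t i => t ⟨n, i⟩) ⁻¹' Φ n, ?_, fun n => h𝒞 _ _ _ (by fun_prop) _ (hΦ n), hf⟩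
  exact continuous_pi fun i => (continuous_apply i.2).comp (hc i.1)

theorem IsSierpinskiPullback.iInter
    (h𝒞 : ∀ (T T' : Type) [TopologicalSpace T] [TopologicalSpace T'] (h : T → T'),
      Continuous h → ∀ s ∈ 𝒞 T', h ⁻¹' s ∈ 𝒞 T)
    {f : ℕ → Set K} (hf : ∀ n, IsSierpinskiPullback 𝒞 (f n)) :
    IsSierpinskiPullback (fun T _ => countableInters (𝒞 T)) (⋂ n, f n) := by
  obtain ⟨ι, hι, c, Φ, hc, hΦ, hf⟩ := exists_common h𝒞 hf
  exact ⟨ι, hι, c, ⋂ n, Φ n, hc, ⟨Φ, hΦ, rfl⟩,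
    by simp only [hf, preimage_iInter]⟩

theorem IsSierpinskiPullback.iUnion
    (h𝒞 : ∀ (T T' : Type) [TopologicalSpace T] [TopologicalSpace T'] (h : T → T'),
      Continuous h → ∀ s ∈ 𝒞 T', h ⁻¹' s ∈ 𝒞 T)
    {f : ℕ → Set K} (hf : ∀ n, IsSierpinskiPullback 𝒞 (f n)) :
    IsSierpinskiPullback (fun T _ => countableUnions (𝒞 T)) (⋃ n, f n) := by
  obtain ⟨ι, hι, c, Φ, hc, hΦ, hf⟩ := exists_common h𝒞 hf
  exact ⟨ι, hι, c, ⋃ n, Φ n, hc, ⟨Φ, hΦ, rfl⟩,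
    by simp only [hf, preimage_iUnion]⟩

theorem continuous_mem_of_isOpen {s : Set K} (hs : IsOpen s) :
    Continuous fun (x : K) (_ : Unit) => x ∈ s :=
  continuous_pi fun _ => continuous_Prop.2 hs

/-- A set in the algebra generated by the open sets involves only finitely many of them. -/
theorem exists_finite_pullback_of_mem_multiplicativeBorel_zero {A : Set K}
    (hA : A ∈ multiplicativeBorel K 0) :
    ∃ (ι : Type) (_ : Finite ι) (c : K → ι → Prop) (Φ : Set (ι → Prop)),
      Continuous c ∧ Φ ∈ multiplicativeBorel (ι → Prop) 0 ∧ A = c ⁻¹' Φ := by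
  rw [multiplicativeBorel_zero] at hA
  induction hA with
  | base s hs =>
    refine ⟨Unit, inferInstance, fun x _ => x ∈ s, {t | t ()}, continuous_mem_of_isOpen hs,
      IsOpen.mem_multiplicativeBorel_zero ?_, rfl⟩
    exact continuous_Prop.1 (continuous_apply ())
  | empty =>
    exact ⟨Empty, inferInstance, fun _ i => i.elim, ∅, by fun_prop,
      isSetAlgebra_multiplicativeBorel_zero.empty_mem, rfl⟩
  | compl s _ ih =>
    obtain ⟨ι, hι, c, Φ, hc, hΦ, rfl⟩ := ih
    exact ⟨ι, hι, c, Φᶜ, hc, isSetAlgebra_multiplicativeBorel_zero.compl_mem hΦ, rfl⟩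
  | union s t _ _ ihs iht =>
    obtain ⟨ι, hι, c, Φ, hc, hΦ, rfl⟩ := ihs
    obtain ⟨κ, hκ, d, Ψ, hd, hΨ, rfl⟩ := iht
    refine ⟨ι ⊕ κ, inferInstance, fun x => Sum.elim (c x) (d x),
      (fun t i => t (.inl i)) ⁻¹' Φ ∪ (fun t i => t (.inr i)) ⁻¹' Ψ, ?_,
      isSetAlgebra_multiplicativeBorel_zero.union_mem
        (Continuous.preimage_mem_multiplicativeBorel_zero (by fun_prop) hΦ)
        (Continuous.preimage_mem_multiplicativeBorel_zero (by fun_prop) hΨ), rfl⟩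
    refine continuous_pi ?_
    rintro (i | i)
    · exact (continuous_apply i).comp hc
    · exact (continuous_apply i).comp hd

theorem isSierpinskiPullback_borel (α : Ordinal.{0}) {A : Set K} :
    (A ∈ multiplicativeBorel K α → IsSierpinskiPullback (fun T _ => multiplicativeBorel T α) A) ∧
      (A ∈ additiveBorel K α → IsSierpinskiPullback (fun T _ => additiveBorel T α) A) := by
  induction α using WellFoundedLT.induction generalizing A with
  | ind α ih =>
    rcases eq_or_ne α 0 with rfl | hα
    · simp only [additiveBorel_zero, ← multiplicativeBorel_zero, and_self]
      intro hA
      obtain ⟨ι, hι, c, Φ, h⟩ := exists_finite_pullback_of_mem_multiplicativeBorel_zero hA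
      exact ⟨ι, inferInstance, c, Φ, h⟩
    · have H : ∀ s ∈ borelBelow α K, IsSierpinskiPullback (fun T _ => borelBelow α T) s := by
        intro s hs
        obtain ⟨β, hβ, hs | hs⟩ := mem_borelBelow.1 hs
        · exact ((ih β hβ).1 hs).mono fun T _ t ht => mem_borelBelow.2 ⟨β, hβ, .inl ht⟩
        · exact ((ih β hβ).2 hs).mono fun T _ t ht => mem_borelBelow.2 ⟨β, hβ, .inr ht⟩
      simp only [multiplicativeBorel_of_ne_zero hα, additiveBorel_of_ne_zero hα]
      constructor
      · rintro ⟨f, hf, rfl⟩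
        exact .iInter (fun _ _ _ _ _ hh _ => hh.preimage_mem_borelBelow) fun n => H _ (hf n)
      · rintro ⟨f, hf, rfl⟩
        exact .iUnion (fun _ _ _ _ _ hh _ => hh.preimage_mem_borelBelow) fun n => H _ (hf n)

theorem isSierpinskiPullback_fBorel (α : Ordinal.{0}) {A : Set K} (hA : A ∈ fBorel K α) :
    IsSierpinskiPullback (fun T _ => fBorel T α) A := by
  induction α using WellFoundedLT.induction generalizing A with
  | ind α ih =>
    rcases eq_or_ne α 0 with rfl | h0
    · simp [fBorel_zero] at hA
    rcases eq_or_ne α 1 with rfl | h1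
    · simp only [fBorel_one] at hA ⊢
      refine ⟨Unit, inferInstance, fun x _ => x ∈ Aᶜ, {t | t ()}ᶜ,
        continuous_mem_of_isOpen hA.isOpen_compl, ?_, by ext; simp⟩
      exact (continuous_Prop.1 (continuous_apply ())).isClosed_compl
    have H : ∀ s ∈ fBelow α K, IsSierpinskiPullback (fun T _ => fBelow α T) s := by
      intro s hs
      obtain ⟨β, hβ, hs⟩ := mem_fBelow.1 hs
      exact (ih β hβ hs).mono fun T _ t ht => mem_fBelow.2 ⟨β, hβ, ht⟩
    by_cases he : OrdinalIsEven α
    · simp only [fBorel_of_even h0 h1 he] at hA ⊢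
      obtain ⟨f, hf, rfl⟩ := hA
      exact .iUnion (fun _ _ _ _ _ hh _ => hh.preimage_mem_fBelow) fun n => H _ (hf n)
    · simp only [fBorel_of_not_even h0 h1 he] at hA ⊢
      obtain ⟨f, hf, rfl⟩ := hA
      exact .iInter (fun _ _ _ _ _ hh _ => hh.preimage_mem_fBelow) fun n => H _ (hf n)

end Pullbacks

/-! ### Images under maps that are injective over the image -/

section Images

/-- For the closed sets `{x | ¬ c x i}`, the map recording which of their images under `p` miss a
given point. The negations match the convention that `{True}` is open in `Prop`. -/
def imagePattern {K L : Type*} {ι : Type} (p : K → L) (c : K → ι → Prop) (y : L) (i : ι) : Prop :=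
  y ∉ p '' {x | ¬ c x i}

theorem isClosed_setOf_not {K : Type*} [TopologicalSpace K] {ι : Type} {c : K → ι → Prop} (hc : Continuous c) (i : ι) :
    IsClosed {x | ¬ c x i} :=
  (continuous_Prop.1 ((continuous_apply i).comp hc)).isClosed_compl

/-- A point `y` lies in the right-hand side if, when the fibre over `y` meets each of the closed
sets `{x | ¬ c x i}`, `i ∈ s`, it meets all of them in a common point. -/
theorem image_subset_compl_union {K L : Type*} {p : K → L} {A : Set K} {ι : Type}
    {c : K → ι → Prop}
    (hA : ∀ a ∈ A, ∀ k, p k = p a → k = a) (s : Finset ι) :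
    p '' A ⊆ (⋂ i ∈ s, p '' {x | ¬ c x i})ᶜ ∪ p '' (⋂ i ∈ s, {x | ¬ c x i}) := by
  rintro _ ⟨a, ha, rfl⟩
  by_cases h : p a ∈ ⋂ i ∈ s, p '' {x | ¬ c x i}
  · refine .inr ⟨a, ?_, rfl⟩
    simp only [mem_iInter] at h ⊢
    intro i hi
    obtain ⟨k, hk, hka⟩ := h i hi
    rwa [hA a ha k hka] at hk
  · exact .inl h

theorem IsLindelof.exists_isClosed_between {L : Type*} [TopologicalSpace L] [RegularSpace L] {s U : Set L} (hs : IsLindelof s)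
    (hU : IsOpen U) (hsU : s ⊆ U) :
    ∃ C : ℕ → Set L, (∀ n, IsClosed (C n)) ∧ s ⊆ ⋃ n, C n ∧ ⋃ n, C n ⊆ U := by
  have hV : ∀ y ∈ s, ∃ V ∈ 𝓝 y, IsClosed V ∧ V ⊆ U := fun y hy =>
    exists_mem_nhds_isClosed_subset (hU.mem_nhds (hsU hy))
  choose! V hVy hVc hVU using hV
  obtain ⟨t, htc, hts, hst⟩ := hs.elim_nhds_subcover V hVy
  rcases t.eq_empty_or_nonempty with rfl | hne
  · exact ⟨fun _ => ∅, fun _ => isClosed_empty, by simpa using hst, by simp⟩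
  obtain ⟨g, rfl⟩ := htc.exists_eq_range hne
  refine ⟨fun n => V (g n), fun n => hVc _ (hts _ ⟨n, rfl⟩), by simpa using hst, ?_⟩
  exact iUnion_subset fun n => hVU _ (hts _ ⟨n, rfl⟩)

variable {K L : Type*} [TopologicalSpace K] [CompactSpace K] [TopologicalSpace L] [T2Space L]
  {p : K → L} {A : Set K}

theorem continuous_imagePattern {ι : Type} {c : K → ι → Prop} (hp : Continuous p)
    (hc : Continuous c) : Continuous (imagePattern p c) :=
  continuous_pi fun i => continuous_Prop.2 (hp.isClosedMap _ (isClosed_setOf_not hc i)).isOpen_compl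

/-- Over a point of `p '' (c ⁻¹' Φ)` the fibre is a single point and the pattern of its image is its
own. Conversely, if a point `y` passes the test `G s` for every finite `s`, then by compactness
some point of its fibre has exactly the pattern of `y`. -/
theorem image_eq_preimage_inter {ι : Type} {c : K → ι → Prop} (hp : Continuous p)
    (hc : Continuous c) {Φ : Set (ι → Prop)}
    (hA : ∀ a ∈ c ⁻¹' Φ, ∀ k, p k = p a → k = a) {G : Finset ι → Set L}
    (hAG : ∀ s, p '' (c ⁻¹' Φ) ⊆ G s)
    (hG : ∀ s, G s ⊆ (⋂ i ∈ s, p '' {x | ¬ c x i})ᶜ ∪ p '' (⋂ i ∈ s, {x | ¬ c x i})) :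
    p '' (c ⁻¹' Φ) = imagePattern p c ⁻¹' Φ ∩ ⋂ s, G s := by
  apply Subset.antisymm
  · refine subset_inter ?_ (subset_iInter hAG)
    rintro _ ⟨a, ha, rfl⟩
    have : imagePattern p c (p a) = c a := by
      ext i
      constructor
      · intro h
        by_contra hi
        exact h ⟨a, hi, rfl⟩
      · rintro hi ⟨k, hk, hka⟩
        rw [hA a ha k hka] at hk
        exact hk hi
    rwa [mem_preimage, this]
  · rintro y ⟨hy, hyG⟩
    rw [mem_iInter] at hyG
    -- A point of the fibre in all closed sets whose image contains `y`; it lies in no other set of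
    -- the family, so its pattern is that of `y`.
    obtain ⟨x, hxy, hx⟩ := (isClosed_singleton.preimage hp).isCompact.inter_iInter_nonempty
      (fun i : {i // ¬ imagePattern p c y i} => {x | ¬ c x i})
      (fun i => isClosed_setOf_not hc i) (s := p ⁻¹' {y}) fun u => by
        rcases hG _ (hyG (u.map (.subtype _))) with h | ⟨x, hx, hxy⟩
        · refine absurd ?_ h
          simp only [mem_iInter, Finset.mem_map]
          rintro _ ⟨i, -, rfl⟩
          exact not_not.1 i.2
        · refine ⟨x, hxy, ?_⟩
          simp only [mem_iInter, Finset.mem_map] at hx ⊢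
          exact fun i hi => hx i ⟨i, hi, rfl⟩
    have hxc : c x = imagePattern p c y := by
      ext i
      constructor
      · rintro h
        by_contra hi
        exact mem_iInter.1 hx ⟨i, hi⟩ h
      · intro h
        by_contra hi
        exact h ⟨x, hi, hxy⟩
    exact ⟨x, by rwa [mem_preimage, hxc], hxy⟩

theorem compl_union_mem_multiplicativeBorel_zero {ι : Type} {c : K → ι → Prop}
    (hp : Continuous p) (hc : Continuous c) (s : Finset ι) :
    (⋂ i ∈ s, p '' {x | ¬ c x i})ᶜ ∪ p '' (⋂ i ∈ s, {x | ¬ c x i}) ∈ multiplicativeBorel L 0 := by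
  refine isSetAlgebra_multiplicativeBorel_zero.union_mem
    (IsClosed.isOpen_compl (self := ?_)).mem_multiplicativeBorel_zero
    (hp.isClosedMap _ ?_).mem_multiplicativeBorel_zero
  · exact isClosed_biInter fun i _ => hp.isClosedMap _ (isClosed_setOf_not hc i)
  · exact isClosed_biInter fun i _ => isClosed_setOf_not hc i

theorem image_mem_multiplicativeBorel_zero (hp : Continuous p)
    (hA : ∀ a ∈ A, ∀ k, p k = p a → k = a) (h : A ∈ multiplicativeBorel K 0) :
    p '' A ∈ multiplicativeBorel L 0 := by
  obtain ⟨ι, hι, c, Φ, hc, hΦ, rfl⟩ := exists_finite_pullback_of_mem_multiplicativeBorel_zero h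
  rw [image_eq_preimage_inter hp hc hA (image_subset_compl_union hA) fun _ => Subset.rfl]
  have := Fintype.ofFinite (Finset ι)
  refine isSetAlgebra_multiplicativeBorel_zero.inter_mem
    ((continuous_imagePattern hp hc).preimage_mem_multiplicativeBorel_zero hΦ) ?_
  have := isSetAlgebra_multiplicativeBorel_zero.biInter_mem (Finset.univ : Finset (Finset ι))
    fun s _ => compl_union_mem_multiplicativeBorel_zero hp hc s
  simpa using this

/-- For additive classes the pieces of `A` again have singleton fibres over their images, so the
induction is immediate. For multiplicative classes of positive index the tests of
`image_eq_preimage_inter` are countably many sets of class `𝓜₀`. -/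
theorem image_mem_borel (hp : Continuous p) (α : Ordinal.{0})
    (hA : ∀ a ∈ A, ∀ k, p k = p a → k = a) :
    (A ∈ multiplicativeBorel K α → p '' A ∈ multiplicativeBorel L α) ∧
      (A ∈ additiveBorel K α → p '' A ∈ additiveBorel L α) := by
  induction α using WellFoundedLT.induction generalizing A with
  | ind α ih =>
    rcases eq_or_ne α 0 with rfl | hα
    · simp only [additiveBorel_zero, ← multiplicativeBorel_zero, and_self]
      exact image_mem_multiplicativeBorel_zero hp hA
    constructor
    · intro h
      obtain ⟨ι, hι, c, Φ, hc, hΦ, rfl⟩ := (isSierpinskiPullback_borel α).1 h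
      rw [image_eq_preimage_inter hp hc hA (image_subset_compl_union hA) fun _ => Subset.rfl]
      have hd := ((continuous_imagePattern hp hc).preimage_mem_borel α).1 hΦ
      rw [multiplicativeBorel_of_ne_zero hα] at hd ⊢
      exact inter_iInter_mem_countableInters hd fun s => mem_borelBelow.2
        ⟨0, pos_iff_ne_zero.2 hα, .inl (compl_union_mem_multiplicativeBorel_zero hp hc s)⟩
    · simp only [additiveBorel_of_ne_zero hα]
      refine image_mem_countableUnions fun t ht htA => ?_
      obtain ⟨β, hβ, ht⟩ := mem_borelBelow.1 ht
      have := ih β hβ fun a ha => hA a (htA ha)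
      exact mem_borelBelow.2 ⟨β, hβ, ht.imp this.1 this.2⟩

/-- If the image is hereditarily Lindelöf, the sets that cut it out in `image_eq_preimage_inter`
can be chosen to be countable unions of closed sets. -/
theorem exists_mem_fBorel_two_between [RegularSpace L] {ι : Type} {c : K → ι → Prop}
    (hp : Continuous p) (hc : Continuous c) (hA : ∀ a ∈ A, ∀ k, p k = p a → k = a)
    (hAL : IsHereditarilyLindelof (p '' A)) (s : Finset ι) :
    ∃ G ∈ fBorel L 2, p '' A ⊆ G ∧
      G ⊆ (⋂ i ∈ s, p '' {x | ¬ c x i})ᶜ ∪ p '' (⋂ i ∈ s, {x | ¬ c x i}) := by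
  have hH : IsClosed (⋂ i ∈ s, p '' {x | ¬ c x i}) :=
    isClosed_biInter fun i _ => hp.isClosedMap _ (isClosed_setOf_not hc i)
  have hE : IsClosed (p '' ⋂ i ∈ s, {x | ¬ c x i}) :=
    hp.isClosedMap _ (isClosed_biInter fun i _ => isClosed_setOf_not hc i)
  obtain ⟨C, hC, hAC, hCH⟩ := (hAL.isLindelof_subset
    (sdiff_subset (t := ⋂ i ∈ s, p '' {x | ¬ c x i}))).exists_isClosed_between
    hH.isOpen_compl fun _ h => h.2
  refine ⟨⋃ n, (C n ∪ p '' ⋂ i ∈ s, {x | ¬ c x i}),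
    iUnion_mem_fBorel_two fun n => (hC n).union hE, fun y hy => ?_, ?_⟩
  · rw [← iUnion_union]
    by_cases h : y ∈ ⋂ i ∈ s, p '' {x | ¬ c x i}
    · exact .inr ((image_subset_compl_union hA s hy).resolve_left (not_not.2 h))
    · exact .inl (hAC ⟨hy, h⟩)
  · rw [← iUnion_union]
    exact union_subset_union_left _ hCH

/-- In the odd case the Lindelöf property is needed: the tests of `image_eq_preimage_inter` have to
be taken in `𝓕₂`, which lies below every odd class from `𝓕₃` on. -/
theorem image_mem_fBorel [RegularSpace L] (hp : Continuous p) (α : Ordinal.{0})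
    (hA : ∀ a ∈ A, ∀ k, p k = p a → k = a) (hAL : IsHereditarilyLindelof (p '' A))
    (h : A ∈ fBorel K α) : p '' A ∈ fBorel L α := by
  induction α using WellFoundedLT.induction generalizing A with
  | ind α ih =>
    rcases eq_or_ne α 0 with rfl | h0
    · simp [fBorel_zero] at h
    rcases eq_or_ne α 1 with rfl | h1
    · rw [fBorel_one] at h ⊢
      exact hp.isClosedMap _ h
    by_cases he : OrdinalIsEven α
    · rw [fBorel_of_even h0 h1 he] at h ⊢
      refine image_mem_countableUnions (fun t ht htA => ?_) h
      obtain ⟨β, hβ, ht⟩ := mem_fBelow.1 ht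
      exact mem_fBelow.2 ⟨β, hβ, ih β hβ (fun a ha => hA a (htA ha))
        (fun u hu => hAL u (hu.trans (image_mono htA))) ht⟩
    · obtain ⟨ι, hι, c, Φ, hc, hΦ, rfl⟩ := isSierpinskiPullback_fBorel α h
      choose G hG2 hAG hG using exists_mem_fBorel_two_between hp hc hA hAL
      rw [image_eq_preimage_inter hp hc hA hAG hG]
      have hd := (continuous_imagePattern hp hc).preimage_mem_fBorel α hΦ
      have h2 : 2 < α := by
        have h2' : α ≠ 2 := fun h => he (h ▸ ordinalIsEven_two)
        have : 1 < α := lt_of_le_of_ne (Order.one_le_iff_ne_zero.2 h0) h1.symm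
        refine lt_of_le_of_ne ?_ h2'.symm
        rw [← one_add_one_eq_two]
        exact Order.add_one_le_of_lt this
      rw [fBorel_of_not_even h0 h1 he] at hd ⊢
      exact inter_iInter_mem_countableInters hd fun s => mem_fBelow.2 ⟨2, h2, hG2 s⟩

/-- Images of `𝓕`-Borel sets can be enlarged to `𝓕`-Borel sets of the same class without adding
points that have a singleton fibre. -/
theorem exists_mem_fBorel_image_subset (hp : Continuous p)
    (hA : ∀ a ∈ A, ∀ k, p k = p a → k = a) (α : Ordinal.{0}) {S : Set K} (hS : S ∈ fBorel K α) :
    ∃ T ∈ fBorel L α, p '' S ⊆ T ∧ ∀ a ∈ A, p a ∈ T → a ∈ S := by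
  induction α using WellFoundedLT.induction generalizing S with
  | ind α ih =>
    rcases eq_or_ne α 0 with rfl | h0
    · simp [fBorel_zero] at hS
    rcases eq_or_ne α 1 with rfl | h1
    · rw [fBorel_one] at hS ⊢
      refine ⟨p '' S, hp.isClosedMap _ hS, Subset.rfl, ?_⟩
      rintro a ha ⟨k, hk, hka⟩
      rwa [← hA a ha k hka]
    have H : ∀ s ∈ fBelow α K, ∃ T ∈ fBelow α L, p '' s ⊆ T ∧ ∀ a ∈ A, p a ∈ T → a ∈ s := by
      intro s hs
      obtain ⟨β, hβ, hs⟩ := mem_fBelow.1 hs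
      obtain ⟨T, hT, h⟩ := ih β hβ hs
      exact ⟨T, mem_fBelow.2 ⟨β, hβ, hT⟩, h⟩
    by_cases he : OrdinalIsEven α
    · rw [fBorel_of_even h0 h1 he] at hS ⊢
      obtain ⟨f, hf, rfl⟩ := hS
      choose T hT hfT hTf using fun n => H _ (hf n)
      refine ⟨⋃ n, T n, ⟨T, hT, rfl⟩, ?_, fun a ha h => ?_⟩
      · rw [image_iUnion]
        exact iUnion_mono hfT
      · obtain ⟨n, hn⟩ := mem_iUnion.1 h
        exact mem_iUnion.2 ⟨n, hTf n a ha hn⟩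
    · rw [fBorel_of_not_even h0 h1 he] at hS ⊢
      obtain ⟨f, hf, rfl⟩ := hS
      choose T hT hfT hTf using fun n => H _ (hf n)
      refine ⟨⋂ n, T n, ⟨T, hT, rfl⟩, (image_iInter_subset f p).trans (iInter_mono hfT),
        fun a ha h => ?_⟩
      exact mem_iInter.2 fun n => hTf n a ha (mem_iInter.1 h n)

/-- The points with a singleton fibre over `p '' A` are kept out of the enlarged image of `Aᶜ`, and
by surjectivity that image contains everything else. -/
theorem image_mem_gBorel (hp : Continuous p) (hps : p.Surjective)
    (hA : ∀ a ∈ A, ∀ k, p k = p a → k = a) (α : Ordinal.{0}) (h : A ∈ gBorel K α) :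
    p '' A ∈ gBorel L α := by
  obtain ⟨T, hT, hAT, hTA⟩ := exists_mem_fBorel_image_subset hp hA α h
  suffices (p '' A)ᶜ = T by rwa [gBorel, mem_ofPred_eq, this]
  ext y
  obtain ⟨k, rfl⟩ := hps y
  constructor
  · exact fun hk => hAT ⟨k, fun hkA => hk ⟨k, hkA, rfl⟩, rfl⟩
  · rintro hk ⟨a, ha, hak⟩
    exact hTA a ha (hak ▸ hk) ha

theorem image_mem_sets [RegularSpace L] (hp : Continuous p) (hps : p.Surjective)
    (hA : ∀ a ∈ A, ∀ k, p k = p a → k = a) (hAL : IsHereditarilyLindelof (p '' A))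
    (C : DescriptiveClass) (h : A ∈ C.sets K) : p '' A ∈ C.sets L :=
  match C with
  | .multiplicative α _ => (image_mem_borel hp α hA).1 h
  | .additive α _ => (image_mem_borel hp α hA).2 h
  | .F α _ _ => image_mem_fBorel hp α hA hAL h
  | .G α _ _ => image_mem_gBorel hp hps hA α h

end Images

/-! ### Comparison of extensions -/

section Extensions

variable {X Y Z : Type*} [TopologicalSpace X] [TopologicalSpace Y] [TopologicalSpace Z]
  {e : X → Y} {g : Y → Z}

/-- A continuous map between extensions of `X` that is an embedding on `X` sends no point of the
remainder into `X`. -/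
theorem eq_of_map_eq_of_isEmbedding_comp [T2Space Y] (he : DenseRange e) (hec : Continuous e)
    (hg : Continuous g) (hge : IsEmbedding (g ∘ e)) {x : X} {y : Y} (h : g y = g (e x)) :
    y = e x := by
  by_contra hne
  obtain ⟨U, V, hU, hV, hyU, hxV, hUV⟩ := t2_separation hne
  obtain ⟨W, hW, hWV⟩ := hge.isInducing.isOpen_iff.1 (hV.preimage hec)
  have hxW : g (e x) ∈ W := (Set.ext_iff.1 hWV x).2 hxV
  obtain ⟨x', hx'U, hx'W⟩ := he.exists_mem_open (hU.inter (hW.preimage hg))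
    ⟨y, hyU, by rwa [mem_preimage, h]⟩
  exact hUV.ne_of_mem hx'U ((Set.ext_iff.1 hWV x').1 hx'W) rfl

theorem preimage_range_comp_eq [T2Space Y] (he : DenseRange e) (hec : Continuous e)
    (hg : Continuous g) (hge : IsEmbedding (g ∘ e)) : g ⁻¹' range (g ∘ e) = range e := by
  apply Subset.antisymm
  · rintro y ⟨x, hx⟩
    exact ⟨x, (eq_of_map_eq_of_isEmbedding_comp he hec hg hge hx.symm).symm⟩
  · rintro _ ⟨x, rfl⟩
    exact ⟨x, rfl⟩

theorem isHereditarilyLindelof_range [HereditarilyLindelofSpace X] {f : X → Z}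
    (hf : Continuous f) : IsHereditarilyLindelof (range f) := by
  intro t ht
  rw [← image_preimage_eq_of_subset ht]
  exact (HereditarilyLindelofSpace.isLindelof _).image hf

end Extensions

section StoneCech

variable {X : Type u} [TopologicalSpace X] {C : DescriptiveClass}

theorem isCompactification_stoneCechUnit [T35Space X] :
    IsCompactification (stoneCechUnit : X → StoneCech X) :=
  ⟨inferInstance, inferInstance, isEmbedding_stoneCechUnit, denseRange_stoneCechUnit⟩

theorem IsDescriptiveSpace.range_stoneCechUnit_mem (h : IsDescriptiveSpace C X) :
    range (stoneCechUnit : X → StoneCech X) ∈ C.sets (StoneCech X) := by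
  obtain ⟨K, _, φ, ⟨_, _, hφ, -⟩, h⟩ := h
  have hext := stoneCechExtend_extends hφ.continuous
  have hφ' : IsEmbedding (stoneCechExtend hφ.continuous ∘ stoneCechUnit) := by rwa [hext]
  rw [← preimage_range_comp_eq denseRange_stoneCechUnit continuous_stoneCechUnit
    (continuous_stoneCechExtend hφ.continuous) hφ', hext]
  exact (continuous_stoneCechExtend hφ.continuous).preimage_mem_sets C h

theorem isAbsoluteDescriptiveSpace_of_range_stoneCechUnit_mem [HereditarilyLindelofSpace X]
    (h : range (stoneCechUnit : X → StoneCech X) ∈ C.sets (StoneCech X)) :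
    IsAbsoluteDescriptiveSpace C X := by
  intro Y _ _ e he hed
  -- The extension `p : βX → βY` of `e` is surjective and is an embedding on `X`.
  have hu : IsEmbedding (stoneCechUnit ∘ e : X → StoneCech Y) := isEmbedding_stoneCechUnit.comp he
  have hud : DenseRange (stoneCechUnit ∘ e : X → StoneCech Y) :=
    denseRange_stoneCechUnit.comp hed continuous_stoneCechUnit
  have hext := stoneCechExtend_extends hu.continuous
  set p := stoneCechExtend hu.continuous
  have hp : Continuous p := continuous_stoneCechExtend hu.continuous
  have hps : p.Surjective := by
    rw [← range_eq_univ, ← hp.isClosedMap.isClosed_range.closure_eq, ← dense_iff_closure_eq]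
    exact hud.mono (hext ▸ range_comp_subset_range _ _)
  have hpX : p '' range stoneCechUnit = range (stoneCechUnit ∘ e : X → StoneCech Y) := by
    rw [← range_comp, hext]
  have hβ : range (stoneCechUnit ∘ e : X → StoneCech Y) ∈ C.sets (StoneCech Y) := by
    rw [← hpX]
    refine image_mem_sets hp hps ?_ (hpX ▸ isHereditarilyLindelof_range hu.continuous) C h
    rintro _ ⟨x, rfl⟩ k hk
    exact eq_of_map_eq_of_isEmbedding_comp denseRange_stoneCechUnit continuous_stoneCechUnit hp
      (hext ▸ hu) hk
  rw [← preimage_range_comp_eq hed he.continuous continuous_stoneCechUnit hu]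
  exact continuous_stoneCechUnit.preimage_mem_sets C hβ

theorem IsAbsoluteDescriptiveSpace.range_mem_of_isEmbedding (h : IsAbsoluteDescriptiveSpace C X)
    (hC : C.IsBorelOrFBorel) {Y : Type u} [TopologicalSpace Y] [T35Space Y] {e : X → Y}
    (he : IsEmbedding e) : range e ∈ C.sets Y := by
  let e' : X → closure (range e) := fun x => ⟨e x, subset_closure ⟨x, rfl⟩⟩
  have he' : IsEmbedding e' := .of_comp (by fun_prop) continuous_subtype_val he
  have hd : DenseRange e' := by
    rw [DenseRange, Subtype.dense_iff, ← range_comp]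
    exact Subset.rfl
  have := (isClosed_closure (s := range e)).isClosedEmbedding_subtypeVal.image_mem_sets hC
    (h _ e' he' hd)
  rwa [← range_comp] at this

end StoneCech

theorem mainTheorem3 (C : DescriptiveClass) (X : Type u) [TopologicalSpace X]
    [MetrizableSpace X] [SeparableSpace X] :
    (IsDescriptiveSpace C X → IsAbsoluteDescriptiveSpace C X) ∧
    List.TFAE
      [IsDescriptiveSpace C X,
        range (stoneCechUnit : X → StoneCech X) ∈ C.sets (StoneCech X),
        ∀ (K : Type u) [TopologicalSpace K] (φ : X → K),
          IsCompactification φ → range φ ∈ C.sets K,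
        IsAbsoluteDescriptiveSpace C X] ∧
    (C.IsBorelOrFBorel →
      (IsAbsoluteDescriptiveSpace C X ↔
        ∀ (Y : Type u) [TopologicalSpace Y] [T35Space Y] (e : X → Y),
          IsEmbedding e → range e ∈ C.sets Y)) := by
  let := metrizableSpaceMetric X
  have : SecondCountableTopology X := UniformSpace.secondCountable_of_separable X
  refine ⟨fun h => isAbsoluteDescriptiveSpace_of_range_stoneCechUnit_mem
    h.range_stoneCechUnit_mem, ?_, fun hC => ⟨fun h Y _ _ e he => h.range_mem_of_isEmbedding hC he,
      fun h Y _ _ e he _ => h Y e he⟩⟩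
  tfae_have 1 → 2 := fun h => h.range_stoneCechUnit_mem
  tfae_have 2 → 4 := isAbsoluteDescriptiveSpace_of_range_stoneCechUnit_mem
  tfae_have 4 → 3 := fun h K _ φ hφ => by
    have := hφ.compactSpace
    have := hφ.t2Space
    exact h K φ hφ.isEmbedding hφ.denseRange
  tfae_have 3 → 1 := fun h => ⟨StoneCech X, inferInstance, stoneCechUnit,
    isCompactification_stoneCechUnit, h _ _ isCompactification_stoneCechUnit⟩
  tfae_finish
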